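/- Let $V$ be a vertex operator algebra over $\mathbb{C}$ (a $\mathbb{Z}$-graded one, with finite-dimensional weight spaces that vanish in all sufficiently negative weights), with vacuum $\mathbf{1}$, $Y(v,x)=\sum_{k\in\mathbb{Z}}v_kx^{-k-1}$ and Virasoro operators $L(m)$. For an integer $n\ge 0$ let $O_n(V)$ be the linear span of all $$u\circ_n v=\mathrm{Res}_x\,\frac{(1+x)^{\mathrm{wt}\,u+n}\,Y(u,x)v}{x^{2n+2}}\quad(u\in V \text{ homogeneous},\ v\in V)\qquad\text{and all}\qquad (L(-1)+L(0))v\quad(v\in V),$$ and let $A_n(V)=V/O_n(V)$ be the level $n$ Zhu algebra, with product induced by $$u*_n v=\sum_{m=0}^n(-1)^m\binom{m+n}{n}\,\mathrm{Res}_x\,\frac{(1+x)^{\mathrm{wt}\,u+n}\,Y(u,x)v}{x^{n+m+1}}$$ for homogeneous $u$, extended linearly in $u$. Let $n\ge 1$, and let $u\in V$ be homogeneous with $\mathrm{wt}\,u\ge -n$. Put $$V^u=\langle u\rangle^1=\mathrm{span}\{u_{-k_1}\cdots u_{-k_r}\mathbf{1}\mid r\ge 0,\ k_1,\dots,k_r\ge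 1\},$$ and for $r\ge 0$ let $F_r(\mathbf{1})$ be the span of all $u_{-k_1}\cdots u_{-k_m}\mathbf{1}$ with $0\le m\le r$ and $k_1,\dots,k_m\ge 1$. Assume that $V^u$ is the vertex subalgebra generated by $u$, that is, $V^u=\mathrm{span}\{u_{k_1}\cdots u_{k_r}\mathbf{1}\mid r\ge0,\ k_1,\dots,k_r\in\mathbb{Z}\}$, and that the permutation property holds for $u$ acting on $\mathbf{1}$: for all $m\ge 1$, all $k_1,\dots,k_m\in\mathbb{Z}$ and every permutation $\sigma$ of $\{1,\dots,m\}$, $$u_{k_1}\cdots u_{k_m}\mathbf{1}-u_{k_{\sigma(1)}}\cdots u_{k_{\sigma(m)}}\mathbf{1}\in F_{m-1}(\mathbf{1}).$$ Let $A_n^u$ be the subalgebra of $A_n(V)$ generated by the classes $v+O_n(V)$ with $v\in V^u$. Then $A_n^u$ is generated by the elements $$u_{-2n}^{i_{2n}}u_{-2n+1}^{i_{2n-1}}\cdots u_{-1}^{i_1}\mathbf{1}+O_n(V),\qquad i_1,\dots,i_{2n}\in\mathbb{Z}_{\ge0},\quad -n\le i_1\,\mathrm{wt}\,u\le n,$$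 together with the elements $$u_{-1}^{j}\mathbf{1}+O_n(V),\qquad j\ge 1.$$ -/

import Mathlib

/-- A vertex algebra over `ℂ`, with state-field map `Y(u, x) = ∑ₖ uₖ x^(-k-1)`. Each `Y(u, x)` is a
`VertexOperator`, that is, `Y(u, x) v` is a Laurent series in `x`; its `k`-th mode `uₖ` is
`VertexOperator.ncoeff (Y u) k`. All sums in the Jacobi identity are finite, by truncation. -/
class VertexAlgebra (V : Type*) [AddCommGroup V] [Module ℂ V] where
  Y : V →ₗ[ℂ] VertexOperator ℂ V
  vacuum : V
  vacuum_mode : ∀ (k : ℤ) (v : V),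
    VertexOperator.ncoeff (Y vacuum) k v = if k = -1 then v else 0
  mode_vacuum_of_nonneg : ∀ (v : V) (k : ℤ), 0 ≤ k → VertexOperator.ncoeff (Y v) k vacuum = 0
  mode_neg_one_vacuum : ∀ v : V, VertexOperator.ncoeff (Y v) (-1) vacuum = v
  /-- The Jacobi identity, written in components. -/
  jacobi : ∀ (u v w : V) (l m n : ℤ),
    (∑ᶠ i : ℕ, (Ring.choose m i) •
        VertexOperator.ncoeff (Y (VertexOperator.ncoeff (Y u) (l + i) v)) (m + n - i) w) =
      ∑ᶠ i : ℕ, ((-1 : ℤ) ^ i * Ring.choose l i) •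
        (VertexOperator.ncoeff (Y u) (m + l - i) (VertexOperator.ncoeff (Y v) (n + i) w) -
          ((-1 : ℂ) ^ l) •
            VertexOperator.ncoeff (Y v) (n + l - i) (VertexOperator.ncoeff (Y u) (m + i) w))

namespace VertexAlgebra

variable {V : Type*} [AddCommGroup V] [Module ℂ V] [VertexAlgebra V]

/-- The mode `uₖ`, the coefficient of `x^(-k-1)` in `Y(u, x)`. -/
noncomputable def mode (u : V) (k : ℤ) : Module.End ℂ V :=
  VertexOperator.ncoeff (Y u) k

/-- Truncation: `uₖ v = 0` for all large `k`. -/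
theorem exists_mode_eq_zero (u v : V) : ∃ N : ℤ, ∀ k : ℤ, N ≤ k → mode u k v = 0 := by
  refine ⟨-((HahnModule.of ℂ).symm ((Y u : VertexOperator ℂ V) v)).order, fun k hk => ?_⟩
  exact VertexOperator.ncoeff_eq_zero_of_lt_order _ _ _ (by omega)

/-- For a list `[(u¹, k₁), …, (uᵐ, kₘ)]`, the vector `u¹_{k₁} ⋯ uᵐ_{kₘ} v`. -/
noncomputable def modeProd (l : List (V × ℤ)) (v : V) : V :=
  l.foldr (fun p x => mode p.1 p.2 x) v

/-- `⟨S⟩`, the span of all `u¹_{k₁} ⋯ uʳ_{kᵣ} 𝟏` with `uⁱ ∈ S`, `kᵢ ∈ ℤ`: the vertex subalgebra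
generated by `S`. -/
noncomputable def generated (S : Set V) : Submodule ℂ V :=
  Submodule.span ℂ {x | ∃ l : List (V × ℤ), (∀ p ∈ l, p.1 ∈ S) ∧ x = modeProd l vacuum}

/-- `⟨S⟩^K`, the span of all `u¹_{k₁} ⋯ uʳ_{kᵣ} 𝟏` with `uⁱ ∈ S` and `kᵢ ≤ -K`. -/
noncomputable def positivelyGenerated (S : Set V) (K : ℤ) : Submodule ℂ V :=
  Submodule.span ℂ
    {x | ∃ l : List (V × ℤ), (∀ p ∈ l, p.1 ∈ S ∧ p.2 ≤ -K) ∧ x = modeProd l vacuum}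

/-- `F_r(v)`, the span of all `u¹_{-k₁} ⋯ uᵐ_{-kₘ} v` with `uⁱ ∈ S`, `kᵢ ≥ K` and `m ≤ r`. -/
noncomputable def filtration (S : Set V) (K : ℤ) (r : ℕ) (v : V) : Submodule ℂ V :=
  Submodule.span ℂ
    {x | ∃ l : List (V × ℤ),
      (∀ p ∈ l, p.1 ∈ S ∧ p.2 ≤ -K) ∧ l.length ≤ r ∧ x = modeProd l v}

/-- The permutation property for `U` acting on `W`, relative to the filtration `F_r` given by `S`
and `K`: permuting the `m` factors of `u¹_{k₁} ⋯ uᵐ_{kₘ} v`, where `uⁱ ∈ U`, `kᵢ ∈ ℤ`, `v ∈ W`,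
changes this vector by an element of `F_{m-1}(v)`. -/
def PermutationProperty (S : Set V) (K : ℤ) (U W : Set V) : Prop :=
  ∀ l l' : List (V × ℤ), l ≠ [] → l.Perm l' → (∀ p ∈ l, p.1 ∈ U) → ∀ v ∈ W,
    modeProd l v - modeProd l' v ∈ filtration S K (l.length - 1) v

/-- `Res_x (1 + x)^a x^(-b) Y(u, x) v`, with `(1 + x)^a` expanded in nonnegative powers of `x`. -/
noncomputable def residue (a b : ℤ) (u v : V) : V :=
  ∑ᶠ i : ℕ, (Ring.choose a i) • mode u (i - b) v

/-- The vector `u_{-N}^{i_N} ⋯ u_{-2}^{i_2} u_{-1}^{i_1} 𝟏`. -/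
noncomputable def orderedMonomial (u : V) (i : ℕ → ℕ) : ℕ → V
  | 0 => vacuum
  | N + 1 => ((mode u (-((N : ℤ) + 1))) ^ (i (N + 1))) (orderedMonomial u i N)

end VertexAlgebra

/-- A vertex operator algebra: a vertex algebra with a conformal vector `ω`, whose modes
`L(m) = ω_{m+1}` satisfy the Virasoro relations, and with a `ℤ`-grading by finite-dimensional
`L(0)`-eigenspaces that vanish in all sufficiently negative weights. -/
class VertexOperatorAlgebra (V : Type*) [AddCommGroup V] [Module ℂ V] extends VertexAlgebra V where
  conformal : V
  centralCharge : ℂ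
  virasoro : ∀ (m n : ℤ) (v : V),
    VertexAlgebra.mode conformal (m + 1) (VertexAlgebra.mode conformal (n + 1) v) -
        VertexAlgebra.mode conformal (n + 1) (VertexAlgebra.mode conformal (m + 1) v) =
      ((m : ℂ) - n) • VertexAlgebra.mode conformal (m + n + 1) v +
        (if m + n = 0 then ((m : ℂ) ^ 3 - m) / 12 * centralCharge else 0) • v
  derivative : ∀ (v : V) (k : ℤ) (w : V),
    VertexAlgebra.mode (VertexAlgebra.mode conformal 0 v) k w =
      (-(k : ℂ)) • VertexAlgebra.mode v (k - 1) w
  weightSpace : ℤ → Submodule ℂ V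
  decomposition : DirectSum.Decomposition weightSpace
  weightSpace_finite : ∀ k : ℤ, FiniteDimensional ℂ (weightSpace k)
  weightSpace_bddBelow : ∃ N : ℤ, ∀ k : ℤ, k < N → weightSpace k = ⊥
  weightSpace_eigen : ∀ (k : ℤ), ∀ v ∈ weightSpace k,
    VertexAlgebra.mode conformal 1 v = (k : ℂ) • v

namespace VertexOperatorAlgebra

open VertexAlgebra

variable {V : Type*} [AddCommGroup V] [Module ℂ V] [VertexOperatorAlgebra V]

/-- The Virasoro operator `L(m) = ω_{m+1}`. -/
noncomputable def virasoroL (m : ℤ) : Module.End ℂ V :=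
  mode (conformal : V) (m + 1)

/-- The component of `u` in the weight space of weight `k`. -/
noncomputable def component (k : ℤ) (u : V) : V :=
  letI := decomposition (V := V)
  (DirectSum.decompose (weightSpace (V := V)) u k : V)

/-- The circle product `u ∘ₙ v = Res_x (1 + x)^(k+n) x^(-2n-2) Y(u, x) v`, for `u` of weight `k`. -/
noncomputable def circ (n : ℕ) (k : ℤ) (u v : V) : V :=
  residue (k + n) (2 * n + 2) u v

/-- `u *ₙ v = ∑_{m=0}^n (-1)^m C(m+n, n) Res_x (1 + x)^(k+n) x^(-n-m-1) Y(u, x) v`, for `u` of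
weight `k`. -/
noncomputable def starHom (n : ℕ) (k : ℤ) (u v : V) : V :=
  ∑ m ∈ Finset.range (n + 1),
    ((-1 : ℤ) ^ m * ((m + n).choose n : ℤ)) • residue (k + n) (n + m + 1) u v

/-- The product `u *ₙ v` for arbitrary `u`, extended linearly from homogeneous `u`. -/
noncomputable def star (n : ℕ) (u v : V) : V :=
  ∑ᶠ k : ℤ, starHom n k (component k u) v

variable (V) in
/-- `Oₙ(V)`, spanned by all `u ∘ₙ v` with `u` homogeneous and by all `(L(-1) + L(0)) v`. -/
noncomputable def zhuO (n : ℕ) : Submodule ℂ V :=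
  Submodule.span ℂ
    ({x | ∃ (k : ℤ) (u v : V), u ∈ weightSpace (V := V) k ∧ x = circ n k u v} ∪
      {x | ∃ v : V, x = virasoroL (-1) v + virasoroL 0 v})

variable (V) in
/-- The level `n` Zhu algebra `Aₙ(V) = V / Oₙ(V)`. -/
abbrev ZhuAlgebra (n : ℕ) : Type _ := V ⧸ zhuO V n

/-- The class `v + Oₙ(V)` of `v`. -/
noncomputable def toZhu (n : ℕ) (v : V) : ZhuAlgebra V n := Submodule.Quotient.mk v

/-- The subspace `B` of `Aₙ(V)` is closed under the product
`(a + Oₙ(V)) (b + Oₙ(V)) = a *ₙ b + Oₙ(V)` of `Aₙ(V)`, for all representatives `a`, `b`. -/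
def IsMulClosed (n : ℕ) (B : Submodule ℂ (ZhuAlgebra V n)) : Prop :=
  ∀ a b : V, toZhu n a ∈ B → toZhu n b ∈ B → toZhu n (star n a b) ∈ B

/-- The subalgebra of `Aₙ(V)` generated by `S`: the smallest linear subspace that contains `S` and
the unit `𝟏 + Oₙ(V)` and is closed under the product. -/
noncomputable def zhuAdjoin (n : ℕ) (S : Set (ZhuAlgebra V n)) : Submodule ℂ (ZhuAlgebra V n) :=
  sInf {B | S ⊆ B ∧ toZhu n (vacuum : V) ∈ B ∧ IsMulClosed n B}

end VertexOperatorAlgebra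

/-!
The inclusion of the algebra generated by the listed elements is clear, so let `C ⊆ V` be a subspace
that contains `Oₙ(V)` and representatives of the listed elements and is closed under `*ₙ`; the point
is that every `F_r(𝟏)` lies in `C`, by induction on `r`. Write `x_k` for the mode `u_{-k}`. Modulo
`F_{r-1}(𝟏) ⊆ C` the modes of `u` in a monomial `x_{k₁} ⋯ x_{kᵣ} 𝟏` commute, and a monomial with a
nonnegative mode vanishes, by the permutation property. The relations below are between monomials
of the same length `r`, up to elements of `C`.

* `Res (1 + x)^(wt u + n) x^(-K) Y(u, x) y ∈ Oₙ(V)` for all `K ≥ 2n + 2` (`residue_mem_zhuO`), so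
  that `x_K y` is a combination of `x_k y` with `k < K`.
* `u *ₙ y ∈ C` for shorter `y` does the same for `x_{2n+1} y`. The coefficient of `x_1 y` in `u *ₙ y`
  is `± C(wt u + n, n) C(wt u - 1, n)`, which vanishes exactly for `0 < |wt u| ≤ n`
  (`starCoeff_eq_zero_iff`); in that range `x_1` does not occur in the reduction of `x_K` with
  `K ≥ 2n + 2` either, because `wt u + n < K - 1`.

It remains to treat monomials in `x_1, …, x_{2n}` with `p` factors `x_1`, by induction on `p`.

* If `0 < |wt u| ≤ n` and `|p wt u| > n`, take the product of `a = u_{-1}^p 𝟏` with the product `y` of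
  the other factors. Up to shorter monomials, `Y(a, x)` is the `p`-th power of `∑ x_k x^(k-1)`
  (`mode_pow_monomial`), so `a_{-1} y` is the given monomial, the lower modes of `a` give monomials
  with fewer factors `x_1`, and the coefficient of `a_{-1} y` in `a *ₙ y` is nonzero
  (`monomial_mem_of_small_weight`).
* If `|wt u| > n` or `wt u = 0`, let `x_1 y` be the given monomial. In `(L(-1) + L(0)) x_{2n} y` all
  terms have fewer than `p` factors `x_1`, and the only one with a factor outside `x_1, …, x_{2n}` is
  a positive multiple of `x_{2n+1} y`. Hence `x_{2n+1} y ∈ C`, and `u *ₙ y`, in which `x_1 y` has a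
  nonzero coefficient, gives `x_1 y ∈ C` (`monomial_mem_of_large_weight`).
-/

/-! ### Binomial coefficients with integer upper argument -/

/-- The coefficient of `v_{-1}` in the product `v *ₙ ·`, for `v` of weight `W`. -/
def starCoeff (n : ℕ) (W : ℤ) : ℤ :=
  ∑ m ∈ Finset.range (n + 1),
    ((-1 : ℤ) ^ m * ((m + n).choose n : ℤ)) * Ring.choose (W + n) (n + m)

theorem sum_range_neg_one_pow_mul_choose (W : ℤ) (N : ℕ) :
    ∑ m ∈ Finset.range (N + 1), (-1 : ℤ) ^ m * Ring.choose W m =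
      (-1) ^ N * Ring.choose (W - 1) N := by
  induction N with
  | zero => simp
  | succ N ih =>
    rw [Finset.sum_range_succ, ih]
    have h := Ring.choose_succ_succ (W - 1) N
    rw [sub_add_cancel] at h
    rw [h]
    ring

theorem starCoeff_eq (n : ℕ) (W : ℤ) :
    starCoeff n W = (-1) ^ n * (Ring.choose (W + n) n * Ring.choose (W - 1) n) := by
  have h : ∀ m : ℕ, ((m + n).choose n : ℤ) * Ring.choose (W + n) (n + m) =
      Ring.choose (W + n) n * Ring.choose W m := by
    intro m
    have h := Ring.choose_smul_choose (W + n) (n := n + m) (k := n) (by omega)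
    simpa [add_comm m n] using h
  calc starCoeff n W = Ring.choose (W + n) n *
        ∑ m ∈ Finset.range (n + 1), (-1 : ℤ) ^ m * Ring.choose W m := by
        rw [starCoeff, Finset.mul_sum]
        refine Finset.sum_congr rfl fun m _ => ?_
        rw [mul_assoc, h]
        ring
    _ = _ := by
        rw [sum_range_neg_one_pow_mul_choose]
        ring

theorem Ring.choose_int_eq_zero_iff (a : ℤ) (k : ℕ) :
    Ring.choose a k = 0 ↔ 0 ≤ a ∧ a < k := by
  rcases le_or_gt 0 a with ha | ha
  · lift a to ℕ using ha
    rw [Ring.choose_natCast]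
    simp [Nat.choose_eq_zero_iff]
  · refine ⟨fun h => ?_, fun h => by omega⟩
    obtain ⟨b, rfl⟩ : ∃ b : ℕ, a = -((b : ℤ) + 1) := ⟨(-a - 1).toNat, by omega⟩
    rw [Ring.choose_neg, show ((b : ℤ) + 1 + k - 1) = ((b + k : ℕ) : ℤ) by push_cast; ring,
      Ring.choose_natCast] at h
    have h2 : ((b + k).choose k : ℤ) ≠ 0 := by
      exact_mod_cast (Nat.choose_pos (by omega)).ne'
    exact absurd ((smul_eq_zero_iff_eq _).1 h) h2

theorem starCoeff_eq_zero_iff (n : ℕ) (W : ℤ) :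
    starCoeff n W = 0 ↔ W ≠ 0 ∧ -(n : ℤ) ≤ W ∧ W ≤ n := by
  rw [starCoeff_eq, mul_eq_zero, mul_eq_zero, Ring.choose_int_eq_zero_iff,
    Ring.choose_int_eq_zero_iff]
  have : ((-1 : ℤ) ^ n) ≠ 0 := by positivity
  simp only [this, false_or]
  omega

/-! ### Membership in submodules and lists of pairs -/

theorem zsmul_mem_iff_of_ne_zero {V : Type*} [AddCommGroup V] [Module ℂ V]
    (C : Submodule ℂ V) {c : ℤ} (hc : c ≠ 0) {v : V} :
    c • v ∈ C ↔ v ∈ C := by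
  rw [← Int.cast_smul_eq_zsmul ℂ, Submodule.smul_mem_iff _ (by exact_mod_cast hc)]

theorem map_snd_map_of_fst_eq {V : Type*} {u : V} {l : List (V × ℤ)} (hl : ∀ p ∈ l, p.1 = u) :
    (l.map Prod.snd).map (fun k => (u, k)) = l := by
  rw [List.map_map]
  conv_rhs => rw [← List.map_id l]
  exact List.map_congr_left fun p hp => Prod.ext (hl p hp).symm rfl

/-- Finiteness of the support is needed: otherwise the `finsum` is `0` by convention. -/
theorem finsum_sub_sum_mem {ι V : Type*} [AddCommGroup V] [Module ℂ V] (N : Submodule ℂ V)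
    (f : ι → V) (hf : f.support.Finite) (s : Finset ι) (h : ∀ i ∉ s, f i ∈ N) :
    ∑ᶠ i, f i - ∑ i ∈ s, f i ∈ N := by
  classical
  rw [finsum_eq_sum_of_support_subset f (s := hf.toFinset ∪ s) (by simp),
    ← Finset.sum_sdiff (Finset.subset_union_right (s₁ := hf.toFinset) (s₂ := s)),
    add_sub_cancel_right]
  exact N.sum_mem fun i hi => h i (Finset.mem_sdiff.1 hi).2

theorem finite_support_of_eventually_zero {V : Type*} [Zero V] (f : ℕ → V) (M : ℕ)
    (h : ∀ i, M ≤ i → f i = 0) : f.support.Finite := by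
  refine (Finset.range M).finite_toSet.subset fun i hi => ?_
  by_contra hM
  exact hi (h i (by simpa using hM))

namespace VertexAlgebra

variable {V : Type*} [AddCommGroup V] [Module ℂ V] [VertexAlgebra V]

/-! ### Commutator and iterate formulas -/

theorem exists_nat_mode_add_eq_zero (u v : V) (k : ℤ) :
    ∃ M : ℕ, ∀ i : ℕ, M ≤ i → mode u (k + i) v = 0 := by
  obtain ⟨N, hN⟩ := exists_mode_eq_zero u v
  exact ⟨(N - k).toNat, fun i hi => hN _ (by omega)⟩

/-- The commutator formula, the case `l = 0` of the Jacobi identity. -/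
theorem finsum_choose_smul_mode_mode (u v w : V) (m n : ℤ) :
    ∑ᶠ i : ℕ, Ring.choose m i • mode (mode u i v) (m + n - i) w =
      mode u m (mode v n w) - mode v n (mode u m w) := by
  have h := jacobi u v w 0 m n
  rw [finsum_eq_single (fun i : ℕ => ((-1 : ℤ) ^ i * Ring.choose (0 : ℤ) i) •
        (VertexOperator.ncoeff (Y u) (m + 0 - i) (VertexOperator.ncoeff (Y v) (n + i) w) -
          ((-1 : ℂ) ^ (0 : ℤ)) •
            VertexOperator.ncoeff (Y v) (n + 0 - i) (VertexOperator.ncoeff (Y u) (m + i) w))) 0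
      (fun i hi => by simp [Ring.choose_zero_pos ℤ (Nat.pos_of_ne_zero hi)])] at h
  simpa [mode] using h

/-- The iterate formula for `u_{-1} v`, the case `l = -1`, `m = 0` of the Jacobi identity. -/
theorem mode_mode_neg_one (u v w : V) (k : ℤ) :
    mode (mode u (-1) v) k w =
      ∑ᶠ i : ℕ, (mode u (-1 - i) (mode v (k + i) w) + mode v (k - 1 - i) (mode u i w)) := by
  have h := jacobi u v w (-1) 0 k
  rw [finsum_eq_single (fun i : ℕ => Ring.choose (0 : ℤ) i •
        VertexOperator.ncoeff (Y (VertexOperator.ncoeff (Y u) (-1 + i) v)) (0 + k - i) w) 0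
      (fun i hi => by simp [Ring.choose_zero_pos ℤ (Nat.pos_of_ne_zero hi)])] at h
  have h1 : ∀ i : ℕ, (-1 : ℤ) ^ i * Ring.choose (-1 : ℤ) i = 1 := by
    intro i
    rw [Ring.choose_neg, show (1 : ℤ) + i - 1 = (i : ℤ) by ring, Ring.choose_natCast]
    rcases Nat.even_or_odd i with hi | hi
    · simp [Int.negOnePow_even _ ((Int.even_coe_nat i).2 hi), hi.neg_one_pow]
    · simp [Int.negOnePow_odd _ ((Int.odd_coe_nat i).2 hi), hi.neg_one_pow]
  simp only [h1] at h
  simpa [mode, sub_eq_add_neg] using h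

theorem finite_support_mode_mode_neg_one (u v w : V) (k : ℤ) :
    (fun i : ℕ => mode u (-1 - i) (mode v (k + i) w) +
      mode v (k - 1 - i) (mode u i w)).support.Finite := by
  obtain ⟨M₁, h₁⟩ := exists_nat_mode_add_eq_zero v w k
  obtain ⟨M₂, h₂⟩ := exists_nat_mode_add_eq_zero u w 0
  refine finite_support_of_eventually_zero _ (M₁ + M₂) fun i hi => ?_
  have := h₂ i (by omega)
  rw [zero_add] at this
  simp [h₁ i (by omega), this]

/-! ### Residues -/

theorem exists_residue_eq_sum (a b : ℤ) (u v : V) :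
    ∃ M₀ : ℕ, ∀ M : ℕ, M₀ ≤ M →
      residue a b u v = ∑ i ∈ Finset.range M, Ring.choose a i • mode u (i - b) v := by
  obtain ⟨M₀, h₀⟩ := exists_nat_mode_add_eq_zero u v (-b)
  refine ⟨M₀, fun M hM => finsum_eq_sum_of_support_subset _ fun i hi => ?_⟩
  by_contra hi'
  refine hi ?_
  have := h₀ i (by simp at hi'; omega)
  rw [neg_add_eq_sub] at this
  simp [this]

/-- Only the terms with negative modes matter modulo a subspace that contains all `u_k v` with
`k ≥ 0`. -/
theorem residue_sub_sum_mem (N : Submodule ℂ V) (a : ℤ) (b : ℕ) (u v : V)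
    (h : ∀ k : ℤ, 0 ≤ k → mode u k v ∈ N) :
    residue a b u v - ∑ i ∈ Finset.range b, Ring.choose a i • mode u (i - b) v ∈ N := by
  obtain ⟨M₀, h₀⟩ := exists_residue_eq_sum a b u v
  rw [h₀ (M₀ + b) (by omega), add_comm M₀, Finset.sum_range_add, add_sub_cancel_left]
  exact N.sum_mem fun i _ => N.toAddSubgroup.zsmul_mem (h _ (by push_cast; omega)) _

end VertexAlgebra

namespace VertexOperatorAlgebra

open VertexAlgebra

variable {V : Type*} [AddCommGroup V] [Module ℂ V] [VertexOperatorAlgebra V]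

/-! ### Weights -/

theorem component_of_mem {k : ℤ} {v : V} (hv : v ∈ weightSpace (V := V) k) :
    component k v = v := by
  let := decomposition (V := V)
  exact DirectSum.decompose_of_mem_same _ hv

theorem component_of_mem_ne {k j : ℤ} {v : V} (hv : v ∈ weightSpace (V := V) k) (h : k ≠ j) :
    component j v = 0 := by
  let := decomposition (V := V)
  exact DirectSum.decompose_of_mem_ne _ hv h

theorem component_add (k : ℤ) (u v : V) : component k (u + v) = component k u + component k v := by
  let := decomposition (V := V)
  simp [component]

theorem component_smul (k : ℤ) (c : ℂ) (v : V) : component k (c • v) = c • component k v := by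
  let := decomposition (V := V)
  simp [component, DirectSum.decompose_smul, DirectSum.smul_apply]

theorem component_conformal_mode_one (j : ℤ) (v : V) :
    component j (mode (conformal : V) 1 v) = (j : ℂ) • component j v := by
  let := decomposition (V := V)
  induction v using DirectSum.Decomposition.inductionOn (weightSpace (V := V)) with
  | zero =>
    have h : component j (0 : V) = 0 := component_of_mem_ne (zero_mem (weightSpace (j + 1)))
      (by omega)
    simp [h]
  | homogeneous m =>
    rename_i i
    rw [weightSpace_eigen i (m : V) m.2, component_smul]
    by_cases h : i = j
    · subst h
      rfl
    · rw [component_of_mem_ne m.2 h, smul_zero, smul_zero]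
  | add a b ha hb => rw [map_add, component_add, component_add, ha, hb, smul_add]

/-- A vector of `L(0)`-eigenvalue `k` lies in the weight space of weight `k`: its other components
have other eigenvalues. -/
theorem mem_weightSpace_iff {k : ℤ} {v : V} :
    v ∈ weightSpace (V := V) k ↔ mode (conformal : V) 1 v = (k : ℂ) • v := by
  classical
  let := decomposition (V := V)
  refine ⟨weightSpace_eigen k v, fun h => ?_⟩
  rw [← DirectSum.sum_support_decompose (weightSpace (V := V)) v]
  refine Submodule.sum_mem _ fun j _ => ?_
  by_cases hj : j = k
  · rw [← hj]
    exact Subtype.mem _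
  · have h1 := component_conformal_mode_one j v
    rw [h, component_smul, ← sub_eq_zero, ← sub_smul, smul_eq_zero] at h1
    have h2 : component j v = 0 := h1.resolve_left
      (sub_ne_zero.2 fun h3 => hj (by exact_mod_cast h3.symm))
    change component j v ∈ _
    rw [h2]
    exact zero_mem _

theorem vacuum_mem_weightSpace : (vacuum : V) ∈ weightSpace (V := V) 0 := by
  rw [mem_weightSpace_iff]
  simpa [mode] using mode_vacuum_of_nonneg (conformal : V) 1 (by norm_num)

theorem mode_mem_weightSpace {a b : ℤ} {u v : V} (hu : u ∈ weightSpace (V := V) a)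
    (hv : v ∈ weightSpace (V := V) b) (k : ℤ) :
    mode u k v ∈ weightSpace (V := V) (a + b - k - 1) := by
  rw [mem_weightSpace_iff] at *
  have h := finsum_choose_smul_mode_mode (conformal : V) u v 1 k
  rw [finsum_eq_sum_of_support_subset (s := Finset.range 2) _ (fun i hi => by
    by_contra h2
    refine hi ?_
    have h3 : Ring.choose (1 : ℤ) i = 0 := by
      rw [Ring.choose_int_eq_zero_iff]
      simp at h2
      omega
    simp [h3])] at h
  rw [hv, Finset.sum_range_succ, Finset.sum_range_one] at h
  simp only [Ring.choose_zero_right, Ring.choose_one_right, Nat.cast_zero, Nat.cast_one, one_smul,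
    derivative, hu, sub_zero, add_sub_cancel_left, map_smul] at h
  have h4 : mode ((a : ℂ) • u) k v = (a : ℂ) • mode u k v := by simp [mode]
  rw [h4] at h
  rw [eq_add_of_sub_eq h.symm]
  push_cast
  module

/-- `L(-1) u = u_{-2} 𝟏`, which makes `L(-1) u` homogeneous of weight `wt u + 1`. -/
theorem mode_neg_two_vacuum (u : V) : mode (conformal : V) 0 u = mode u (-2) vacuum := by
  rw [← mode_neg_one_vacuum (mode (conformal : V) 0 u)]
  simpa [mode] using derivative u (-1) vacuum

/-- The commutator `[L(-1), u_k] = -k u_{k-1}`. -/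
theorem virasoroL_neg_one_mode (u v : V) (k : ℤ) :
    virasoroL (-1) (mode u k v) = mode u k (virasoroL (-1) v) - (k : ℂ) • mode u (k - 1) v := by
  have h := finsum_choose_smul_mode_mode (conformal : V) u v 0 k
  rw [finsum_eq_single _ 0
    (fun i hi => by simp [Ring.choose_zero_pos ℤ (Nat.pos_of_ne_zero hi)])] at h
  simp only [Ring.choose_zero_right, Nat.cast_zero, one_smul, derivative, sub_zero, zero_add] at h
  simp only [virasoroL, show (-1 + 1 : ℤ) = 0 by norm_num]
  rw [eq_add_of_sub_eq h.symm]
  module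

/-! ### Relations in the Zhu algebra -/

/-- Integration by parts: `Y(L(-1) u, x)` is the derivative of `Y(u, x)`, and
`(1 + x)^(a+1) x^(-b-1) = (1 + x)^a (x^(-b) + x^(-b-1))`. -/
theorem residue_derivative (a b : ℤ) (u v : V) :
    residue (a + 1) b (mode (conformal : V) 0 u) v =
      (b : ℤ) • residue a (b + 1) u v + (b - a - 1) • residue a b u v := by
  obtain ⟨M₁, h₁⟩ := exists_residue_eq_sum (a + 1) b (mode (conformal : V) 0 u) v
  obtain ⟨M₂, h₂⟩ := exists_residue_eq_sum a (b + 1) u v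
  obtain ⟨M₃, h₃⟩ := exists_residue_eq_sum a b u v
  rw [h₁ (M₁ + M₂ + M₃ + 1) (by omega), h₂ (M₁ + M₂ + M₃ + 1) (by omega),
    h₃ (M₁ + M₂ + M₃) (by omega), Finset.sum_range_succ', Finset.sum_range_succ', smul_add,
    Finset.smul_sum, Finset.smul_sum]
  have hz : ∀ (k : ℤ) (x : V), (-(k : ℂ)) • x = (-k) • x := fun k x => by
    rw [← Int.cast_neg, Int.cast_smul_eq_zsmul]
  refine (congrArg₂ (· + ·) ?_ ?_).trans (add_right_comm _ _ _)
  · rw [← Finset.sum_add_distrib]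
    refine Finset.sum_congr rfl fun i _ => ?_
    rw [derivative, hz, show ((i + 1 : ℕ) : ℤ) - (b + 1) = i - b by push_cast; ring,
      show ((i + 1 : ℕ) : ℤ) - b - 1 = i - b by push_cast; ring, smul_smul, smul_smul, smul_smul,
      ← add_smul]
    congr 1
    have hp := Ring.choose_succ_succ a i
    have hq : (i + 1 : ℤ) * Ring.choose (a + 1) (i + 1) = (a + 1) * Ring.choose a i := by
      have := Ring.choose_add_smul_choose a i 1
      simpa using this
    push_cast
    linear_combination (-1 : ℤ) * hq + b * hp
  · rw [derivative, hz]
    simp [sub_eq_add_neg, add_comm]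

/-- The residues with a higher pole than in `u ∘ₙ v` lie in `Oₙ(V)` as well: integrating
`u' = L(-1) u` by parts raises the order of the pole. -/
theorem residue_mem_zhuO (n m : ℕ) : ∀ (k : ℤ) (u v : V), u ∈ weightSpace (V := V) k →
    residue (k + n) (2 * n + 2 + m) u v ∈ zhuO V n := by
  induction m with
  | zero =>
    intro k u v hu
    refine Submodule.subset_span (Or.inl ⟨k, u, v, hu, ?_⟩)
    simp [circ]
  | succ m ih =>
    intro k u v hu
    have hu' : mode (conformal : V) 0 u ∈ weightSpace (V := V) (k + 1) := by
      rw [mode_neg_two_vacuum]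
      have h := mode_mem_weightSpace hu vacuum_mem_weightSpace (-2)
      rwa [show k + 0 - -2 - 1 = k + 1 by ring] at h
    have h1 := ih (k + 1) _ v hu'
    rw [show k + 1 + (n : ℤ) = k + n + 1 by ring, residue_derivative] at h1
    have h2 := (Submodule.add_mem_iff_left _
      ((zhuO V n).toAddSubgroup.zsmul_mem (ih k u v hu) _)).1 h1
    rw [← Int.cast_smul_eq_zsmul ℂ, Submodule.smul_mem_iff _
      (by exact_mod_cast (by omega : (2 * (n : ℤ) + 2 + m) ≠ 0))] at h2
    rwa [Nat.cast_succ, ← add_assoc]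

theorem star_of_mem {k : ℤ} {u : V} (hu : u ∈ weightSpace (V := V) k) (n : ℕ) (v : V) :
    star n u v = starHom n k u v := by
  rw [star, finsum_eq_single _ k, component_of_mem hu]
  intro j hj
  rw [component_of_mem_ne hu hj.symm]
  simp [starHom, residue, mode]

/-- In `u *ₙ v`, modulo a subspace that contains all other `u_k v` with `k > -2n - 1`, only the lowest
mode `u_{-2n-1}`, from the summand `m = n`, and the mode `u_{-1}`, from every summand, remain. -/
theorem starHom_sub_mem (N : Submodule ℂ V) (n : ℕ) (hn : 1 ≤ n) (W : ℤ) (u v : V)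
    (h : ∀ k : ℤ, -(2 * n + 1 : ℤ) < k → k ≠ -1 → mode u k v ∈ N) :
    starHom n W u v - (starCoeff n W • mode u (-1) v +
      ((-1 : ℤ) ^ n * ((n + n).choose n : ℤ)) • mode u (-(2 * n + 1 : ℤ)) v) ∈ N := by
  have hr : ∀ m : ℕ, residue (W + n) (n + m + 1) u v -
      (Ring.choose (W + n) (n + m) • mode u (-1) v +
        if m = n then mode u (-(2 * n + 1 : ℤ)) v else 0) ∈ N ∨ n < m := by
    intro m
    refine or_iff_not_imp_right.2 fun hm => ?_
    have h1 := residue_sub_sum_mem N (W + n) (n + m + 1) u v fun k hk => h k (by omega) (by omega)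
    rw [Finset.sum_range_succ] at h1
    push_cast at h1
    have h2 : ∑ i ∈ Finset.range (n + m), Ring.choose (W + n) i • mode u (i - (n + m + 1)) v -
        (if m = n then mode u (-(2 * n + 1 : ℤ)) v else 0) ∈ N := by
      obtain ⟨s, hs⟩ : ∃ s, n + m = s + 1 := ⟨n + m - 1, by omega⟩
      rw [hs, Finset.sum_range_succ', add_sub_assoc]
      refine N.add_mem (N.sum_mem fun i hi => N.toAddSubgroup.zsmul_mem (h _ ?_ ?_) _) ?_
      · push_cast; omega
      · have := Finset.mem_range.1 hi
        push_cast; omega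
      · split_ifs with hmn
        · subst hmn
          rw [Ring.choose_zero_right, one_smul,
            show ((0 : ℕ) : ℤ) - (m + m + 1) = -(2 * m + 1) by push_cast; ring, sub_self]
          exact N.zero_mem
        · rw [sub_zero]
          exact N.toAddSubgroup.zsmul_mem (h _ (by push_cast; omega) (by push_cast; omega)) _
    have h3 := N.add_mem h1 h2
    convert h3 using 1
    rw [show ((n : ℤ) + m - (n + m + 1)) = -1 by ring]
    abel
  have hsum : starCoeff n W • mode u (-1) v +
      ((-1 : ℤ) ^ n * ((n + n).choose n : ℤ)) • mode u (-(2 * n + 1 : ℤ)) v =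
      ∑ m ∈ Finset.range (n + 1), ((-1 : ℤ) ^ m * ((m + n).choose n : ℤ)) •
        (Ring.choose (W + n) (n + m) • mode u (-1) v +
          if m = n then mode u (-(2 * n + 1 : ℤ)) v else 0) := by
    simp only [smul_add, Finset.sum_add_distrib, smul_smul, ← Finset.sum_smul, starCoeff,
      smul_ite, smul_zero, Finset.sum_ite_eq']
    simp
  rw [starHom, hsum, ← Finset.sum_sub_distrib]
  refine N.sum_mem fun m hm => ?_
  rw [← smul_sub]
  have := Finset.mem_range.1 hm
  exact N.toAddSubgroup.zsmul_mem ((hr m).resolve_right (by omega)) _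

end VertexOperatorAlgebra

namespace VertexAlgebra

variable {V : Type*} [AddCommGroup V] [Module ℂ V] [VertexAlgebra V]

/-! ### Monomials in the modes of one vector -/

/-- The vector `u_{k₁} ⋯ u_{kᵣ} 𝟏` for the list `[k₁, …, kᵣ]`. -/
noncomputable def monomial (u : V) : List ℤ → V
  | [] => vacuum
  | k :: l => mode u k (monomial u l)

theorem monomial_eq_modeProd (u : V) (l : List ℤ) :
    monomial u l = modeProd (l.map fun k => (u, k)) vacuum := by
  induction l with
  | nil => rfl
  | cons k l ih => simp [monomial, modeProd, ih]

theorem monomial_replicate_append (u : V) (k : ℤ) (j : ℕ) (l : List ℤ) :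
    monomial u (List.replicate j k ++ l) = (mode u k ^ j) (monomial u l) := by
  induction j with
  | zero => rfl
  | succ j ih => rw [List.replicate_succ, List.cons_append, monomial, ih, pow_succ']; rfl

theorem monomial_replicate (u : V) (k : ℤ) (j : ℕ) :
    monomial u (List.replicate j k) = (mode u k ^ j) vacuum := by
  simpa [monomial] using monomial_replicate_append u k j []

theorem positivelyGenerated_singleton (u : V) :
    positivelyGenerated {u} 1 =
      Submodule.span ℂ {x | ∃ l : List ℤ, (∀ k ∈ l, k ≤ -1) ∧ x = monomial u l} := by
  refine congrArg _ (Set.ext fun x => ⟨?_, ?_⟩)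
  · rintro ⟨l, hl, rfl⟩
    refine ⟨l.map Prod.snd, by simpa using fun k a h => (hl _ h).2, ?_⟩
    rw [monomial_eq_modeProd, map_snd_map_of_fst_eq fun p hp => (hl p hp).1]
  · rintro ⟨l, hl, rfl⟩
    exact ⟨l.map fun k => (u, k), by simpa using hl, monomial_eq_modeProd u l⟩

/-- The span of the monomials in the modes `u_k`, `k ≤ -1`, that have length less than `r`, or have
length `r` and contain the factor `u_{-1}` fewer than `p` times. For `p = 0` this is
`F_{r-1}(𝟏)`, with `F_{-1}(𝟏) = 0`. -/
noncomputable def lowerSpan (u : V) (r p : ℕ) : Submodule ℂ V :=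
  Submodule.span ℂ {x | ∃ l : List ℤ, (∀ k ∈ l, k ≤ -1) ∧
    (l.length < r ∨ l.length = r ∧ l.count (-1) < p) ∧ x = monomial u l}

theorem monomial_mem_lowerSpan {u : V} {l : List ℤ} (hl : ∀ k ∈ l, k ≤ -1) {r p : ℕ}
    (h : l.length < r ∨ l.length = r ∧ l.count (-1) < p) : monomial u l ∈ lowerSpan u r p :=
  Submodule.subset_span ⟨l, hl, h, rfl⟩

theorem lowerSpan_mono (u : V) {r s p : ℕ} (h : r ≤ s) : lowerSpan u r 0 ≤ lowerSpan u s p :=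
  Submodule.span_mono fun _ ⟨l, hl, hr, hx⟩ => ⟨l, hl, Or.inl (by omega), hx⟩

theorem lowerSpan_count_mono (u : V) {r p q : ℕ} (h : p ≤ q) : lowerSpan u r p ≤ lowerSpan u r q :=
  Submodule.span_mono fun _ ⟨l, hl, hr, hx⟩ => ⟨l, hl, by omega, hx⟩

theorem filtration_le_lowerSpan (u : V) (r : ℕ) :
    filtration {u} 1 r vacuum ≤ lowerSpan u (r + 1) 0 := by
  refine Submodule.span_le.2 ?_
  rintro _ ⟨l, hl, hr, rfl⟩
  refine Submodule.subset_span ⟨l.map Prod.snd, by simpa using fun k a h => (hl _ h).2,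
    Or.inl (by rw [List.length_map]; omega), ?_⟩
  rw [monomial_eq_modeProd, map_snd_map_of_fst_eq fun p hp => (hl p hp).1]

theorem monomial_sub_mem_lowerSpan {u : V}
    (hperm : PermutationProperty {u} 1 {u} {(vacuum : V)}) {l l' : List ℤ} (h : l.Perm l') {r : ℕ}
    (hr : l.length ≤ r) : monomial u l - monomial u l' ∈ lowerSpan u r 0 := by
  rcases eq_or_ne l [] with rfl | hl
  · rw [List.nil_perm.1 h, sub_self]
    exact zero_mem _
  · rw [monomial_eq_modeProd, monomial_eq_modeProd]
    refine lowerSpan_mono u ?_ (filtration_le_lowerSpan u _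
      (hperm _ _ (by simpa using hl) (h.map _) (by simp) _ rfl))
    have := List.length_pos_iff.2 hl
    rw [List.length_map]
    omega

theorem mode_mem_lowerSpan {u : V} {k : ℤ} (hk : k ≤ -1) {r p q : ℕ}
    (hq : p = 0 ∨ p + (if k = -1 then 1 else 0) ≤ q) {y : V} (hy : y ∈ lowerSpan u r p) :
    mode u k y ∈ lowerSpan u (r + 1) q := by
  induction hy using Submodule.span_induction with
  | mem x hx =>
    obtain ⟨l, hl, hr, rfl⟩ := hx
    refine monomial_mem_lowerSpan (l := k :: l) (by simpa [hk] using hl) ?_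
    rw [List.count_cons, List.length_cons]
    simp only [beq_iff_eq]
    omega
  | zero => simp
  | add a b _ _ ha hb => rw [map_add]; exact add_mem ha hb
  | smul c a _ ha => rw [map_smul]; exact Submodule.smul_mem _ c ha

/-- By the permutation property, `u_k` with `k ≥ 0` can be moved to the right until it annihilates
the vacuum. -/
theorem mode_mem_lowerSpan_of_nonneg {u : V}
    (hperm : PermutationProperty {u} 1 {u} {(vacuum : V)}) {k : ℤ} (hk : 0 ≤ k) {r : ℕ} {y : V}
    (hy : y ∈ lowerSpan u r 0) : mode u k y ∈ lowerSpan u r 0 := by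
  induction hy using Submodule.span_induction with
  | mem x hx =>
    obtain ⟨l, hl, hr, rfl⟩ := hx
    have h := monomial_sub_mem_lowerSpan hperm
      (List.perm_append_singleton k l).symm (r := r) (by rw [List.length_cons]; omega)
    have h0 : ∀ m : List ℤ, monomial u (m ++ [k]) = 0 := fun m => by
      induction m with
      | nil => exact mode_vacuum_of_nonneg u k hk
      | cons a m ih => rw [List.cons_append, monomial, ih, map_zero]
    rwa [h0, sub_zero] at h
  | zero => simp
  | add a b _ _ ha hb => rw [map_add]; exact add_mem ha hb
  | smul c a _ ha => rw [map_smul]; exact Submodule.smul_mem _ c ha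

/-! ### Modes of the powers of `u_{-1}` -/

theorem mode_pow_succ (u : V) (j : ℕ) (k : ℤ) (y : V) :
    mode ((mode u (-1) ^ (j + 1)) vacuum) k y =
      ∑ᶠ i : ℕ, (mode u (-1 - i) (mode ((mode u (-1) ^ j) vacuum) (k + i) y) +
        mode ((mode u (-1) ^ j) vacuum) (k - 1 - i) (mode u i y)) := by
  rw [pow_succ', Module.End.mul_apply, mode_mode_neg_one]

theorem mode_pow_mem_lowerSpan {u : V} (hperm : PermutationProperty {u} 1 {u} {(vacuum : V)})
    (j : ℕ) : ∀ (k : ℤ) (s : ℕ) (y : V), y ∈ lowerSpan u s 0 →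
      mode ((mode u (-1) ^ j) vacuum) k y ∈ lowerSpan u (s + j) 0 := by
  induction j with
  | zero =>
    intro k s y hy
    have h := vacuum_mode k y
    change mode vacuum k y = _ at h
    rw [pow_zero, Module.End.one_apply, h]
    split_ifs
    exacts [hy, zero_mem _]
  | succ j ih =>
    intro k s y hy
    rw [mode_pow_succ]
    refine finsum_induction (· ∈ lowerSpan u (s + (j + 1)) 0) (zero_mem _)
      (fun _ _ => add_mem) fun i => add_mem ?_ ?_
    · exact mode_mem_lowerSpan (by omega) (Or.inl rfl) (ih _ s y hy)
    · exact lowerSpan_mono u (by omega)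
        (ih _ s _ (mode_mem_lowerSpan_of_nonneg hperm (by omega) hy))

/-- Modulo monomials of smaller length, the field of `u_{-1}^j 𝟏` is the `j`-th power of the
creation part `∑_{k ≥ 1} u_{-k} x^(k-1)`: its nonnegative modes vanish, its `(-1)`-st mode is
`u_{-1}^j`, and the modes below replace some factor `u_{-1}` by another one. -/
theorem mode_pow_monomial {u : V} (hperm : PermutationProperty {u} 1 {u} {(vacuum : V)})
    {l : List ℤ} (hl : ∀ k ∈ l, k ≤ -1) (j : ℕ) :
    (∀ k : ℤ, 0 ≤ k → mode ((mode u (-1) ^ j) vacuum) k (monomial u l) ∈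
      lowerSpan u (l.length + j) 0) ∧
    (mode ((mode u (-1) ^ j) vacuum) (-1) (monomial u l) - (mode u (-1) ^ j) (monomial u l) ∈
      lowerSpan u (l.length + j) 0) ∧
    (∀ k : ℤ, k ≤ -2 → mode ((mode u (-1) ^ j) vacuum) k (monomial u l) ∈
      lowerSpan u (l.length + j) (l.count (-1) + j)) := by
  induction j with
  | zero =>
    have h : ∀ k : ℤ, mode vacuum k (monomial u l) = if k = -1 then monomial u l else 0 :=
      fun k => vacuum_mode k _
    refine ⟨fun k hk => ?_, ?_, fun k hk => ?_⟩
    · rw [pow_zero, Module.End.one_apply, h, if_neg (by omega)]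
      exact zero_mem _
    · rw [pow_zero, Module.End.one_apply, h, if_pos rfl, Module.End.one_apply, sub_self]
      exact zero_mem _
    · rw [pow_zero, Module.End.one_apply, h, if_neg (by omega)]
      exact zero_mem _
  | succ j ih =>
    obtain ⟨ih₀, ih₁, ih₂⟩ := ih
    have hy : monomial u l ∈ lowerSpan u (l.length + 1) 0 :=
      monomial_mem_lowerSpan hl (Or.inl (by omega))
    have hr : ∀ (k : ℤ) (i : ℕ), mode ((mode u (-1) ^ j) vacuum) k (mode u i (monomial u l)) ∈
        lowerSpan u (l.length + (j + 1)) 0 := fun k i => by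
      have := mode_pow_mem_lowerSpan hperm j k _ _
        (mode_mem_lowerSpan_of_nonneg hperm (k := i) (by omega) hy)
      rwa [add_assoc, add_comm 1 j] at this
    have hpow : (mode u (-1) ^ j) (monomial u l) ∈
        lowerSpan u (l.length + j) (l.count (-1) + j + 1) := by
      rw [← monomial_replicate_append]
      refine monomial_mem_lowerSpan ?_ (Or.inr ⟨?_, ?_⟩)
      · intro k hk
        rcases List.mem_append.1 hk with hk | hk
        · exact (List.eq_of_mem_replicate hk).le
        · exact hl k hk
      · simp [add_comm]
      · simp [List.count_append]; omega
    have hall : ∀ k : ℤ, mode ((mode u (-1) ^ j) vacuum) k (monomial u l) ∈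
        lowerSpan u (l.length + j) (l.count (-1) + j + 1) := fun k => by
      rcases lt_trichotomy k (-1) with hk | rfl | hk
      · exact lowerSpan_count_mono u (by omega) (ih₂ k (by omega))
      · rw [← sub_add_cancel (mode _ _ _) ((mode u (-1) ^ j) (monomial u l))]
        exact add_mem (lowerSpan_mono u le_rfl ih₁) hpow
      · exact lowerSpan_mono u le_rfl (ih₀ k (by omega))
    refine ⟨fun k hk => ?_, ?_, fun k hk => ?_⟩
    · rw [mode_pow_succ]
      exact finsum_induction (· ∈ lowerSpan u (l.length + (j + 1)) 0) (zero_mem _)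
        (fun _ _ => add_mem) fun i => add_mem
          (mode_mem_lowerSpan (by omega) (Or.inl rfl) (ih₀ _ (by omega))) (hr _ i)
    · have h := finsum_sub_sum_mem (lowerSpan u (l.length + (j + 1)) 0) _
        (finite_support_mode_mode_neg_one u ((mode u (-1) ^ j) vacuum) (monomial u l) (-1)) {0}
        fun i hi => add_mem (mode_mem_lowerSpan (by omega) (Or.inl rfl)
          (ih₀ _ (by simp at hi; omega))) (hr _ i)
      rw [← mode_pow_succ, Finset.sum_singleton] at h
      have h1 : mode u (-1) (mode ((mode u (-1) ^ j) vacuum) (-1) (monomial u l) -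
          (mode u (-1) ^ j) (monomial u l)) ∈ lowerSpan u (l.length + j + 1) 0 :=
        mode_mem_lowerSpan le_rfl (Or.inl rfl) ih₁
      have h2 := add_mem (add_mem h h1) (hr (-1 - 1 - (0 : ℕ)) 0)
      rw [pow_succ' (mode u (-1)) j, Module.End.mul_apply (mode u (-1))]
      rw [pow_succ' (mode u (-1)) j] at h2
      convert h2 using 1
      simp only [map_sub, Nat.cast_zero, sub_zero, add_zero]
      abel
    · rw [mode_pow_succ]
      refine finsum_induction (· ∈ lowerSpan u (l.length + (j + 1)) (l.count (-1) + (j + 1)))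
        (zero_mem _) (fun _ _ => add_mem) fun i => add_mem ?_ (lowerSpan_mono u le_rfl (hr _ i))
      rcases Nat.eq_zero_or_pos i with rfl | hi
      · exact mode_mem_lowerSpan (by omega) (Or.inr (by simp [add_assoc])) (ih₂ _ (by simpa using hk))
      · exact mode_mem_lowerSpan (by omega) (Or.inr (by rw [if_neg (by omega)]; omega)) (hall _)

end VertexAlgebra

namespace VertexOperatorAlgebra

open VertexAlgebra

variable {V : Type*} [AddCommGroup V] [Module ℂ V] [VertexOperatorAlgebra V]

/-! ### Reduction of monomials in the Zhu algebra -/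

theorem exists_monomial_mem_weightSpace {u : V} {w : ℤ} (hu : u ∈ weightSpace (V := V) w)
    (l : List ℤ) : ∃ c : ℤ, monomial u l ∈ weightSpace (V := V) c := by
  induction l with
  | nil => exact ⟨0, vacuum_mem_weightSpace⟩
  | cons k l ih =>
    obtain ⟨c, hc⟩ := ih
    exact ⟨_, mode_mem_weightSpace hu hc k⟩

theorem mode_neg_one_pow_vacuum_mem_weightSpace {u : V} {w : ℤ}
    (hu : u ∈ weightSpace (V := V) w) (j : ℕ) :
    (mode u (-1) ^ j) vacuum ∈ weightSpace (V := V) (j * w) := by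
  induction j with
  | zero => simpa using vacuum_mem_weightSpace
  | succ j ih =>
    have h := mode_mem_weightSpace hu ih (-1)
    rwa [show w + j * w - -1 - 1 = ((j + 1 : ℕ) : ℤ) * w by push_cast; ring,
      ← Module.End.mul_apply, ← pow_succ'] at h

/-- `L(-1)` acts on monomials as the derivation with `u_k ↦ -k u_{k-1}` that annihilates `𝟏`. -/
theorem virasoroL_neg_one_monomial (u : V) (l : List ℤ) :
    virasoroL (-1) (monomial u l) =
      ∑ i : Fin l.length, (-(l[i] : ℂ)) • monomial u (l.set i (l[i] - 1)) := by
  induction l with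
  | nil =>
    simpa [virasoroL, monomial, mode] using mode_vacuum_of_nonneg (conformal : V) 0 le_rfl
  | cons k l ih =>
    rw [monomial, virasoroL_neg_one_mode, ih, map_sum]
    simp only [List.length_cons]
    rw [Fin.sum_univ_succ, sub_eq_neg_add]
    simp [monomial]

section Reduction

variable {n : ℕ} {u : V} {w : ℤ} {C : Submodule ℂ V}

/-- Modulo `Oₙ(V)` and products with `u`, the vector `u_{-K} y` with `K ≥ 2n + 1` is a combination
of vectors `u_k y` with `k > -K`; the term with `k = -1` does not occur if `0 < |wt u| ≤ n`. -/
theorem mode_mem_of_forall_mode_mem (hn : 1 ≤ n) (hu : u ∈ weightSpace (V := V) w)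
    (hw : -(n : ℤ) ≤ w) (hO : zhuO V n ≤ C) {y : V} (hstar : star n u y ∈ C) {K : ℕ}
    (hK : 2 * n + 1 ≤ K) (hnonneg : ∀ k : ℤ, 0 ≤ k → mode u k y ∈ C)
    (hneg : ∀ k : ℤ, -(K : ℤ) < k → k ≤ -1 → (k = -1 → starCoeff n w ≠ 0) → mode u k y ∈ C) :
    mode u (-K) y ∈ C := by
  rcases hK.eq_or_lt with rfl | hK
  · rw [star_of_mem hu] at hstar
    push_cast at *
    have h := starHom_sub_mem C n hn w u y fun k hk hk1 => by
      rcases le_or_gt 0 k with h0 | h0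
      · exact hnonneg k h0
      · exact hneg k (by omega) (by omega) fun h => absurd h hk1
    have h1 := (C.sub_mem_iff_right hstar).1 h
    have h2 : starCoeff n w • mode u (-1) y ∈ C := by
      by_cases h0 : starCoeff n w = 0
      · rw [h0, zero_smul]
        exact zero_mem _
      · exact C.toAddSubgroup.zsmul_mem (hneg _ (by omega) le_rfl fun _ => h0) _
    refine (zsmul_mem_iff_of_ne_zero C ?_).1 ((C.add_mem_iff_right h2).1 h1)
    exact mul_ne_zero (by positivity) (by exact_mod_cast (Nat.choose_pos (by omega)).ne')
  · obtain ⟨m, rfl⟩ := Nat.exists_eq_add_of_le hK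
    have h := residue_mem_zhuO n m w u y hu
    have h1 := residue_sub_sum_mem C (w + n) (2 * n + 1 + 1 + m) u y hnonneg
    push_cast at h1
    rw [show (2 * (n : ℤ) + 1 + 1 + m) = 2 * n + 2 + m by ring] at h1
    have h2 := (C.sub_mem_iff_right (hO h)).1 h1
    rw [show 2 * n + 1 + 1 + m = (2 * n + 1 + m) + 1 by ring, Finset.sum_range_succ'] at h2
    have h3 := (C.add_mem_iff_right (C.sum_mem fun i hi => ?_)).1 h2
    · convert h3 using 1
      rw [Ring.choose_zero_right, one_smul]
      congr 2
      push_cast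
      ring
    · have hi' := Finset.mem_range.1 hi
      -- The index `i = 2n + m` belongs to `u_{-1} y`. If `0 < |w| ≤ n`, its coefficient is the binomial
      -- coefficient `C(w + n, 2n + m + 1)` with `0 ≤ w + n ≤ 2n`, which vanishes.
      by_cases h0 : i = 2 * n + m ∧ starCoeff n w = 0
      · have h4 : Ring.choose (w + n) (i + 1) = 0 := by
          rw [Ring.choose_int_eq_zero_iff]
          have := (starCoeff_eq_zero_iff n w).1 h0.2
          omega
        rw [h4, zero_smul]
        exact zero_mem _
      · refine C.toAddSubgroup.zsmul_mem (hneg _ ?_ ?_ fun h5 h6 => h0 ⟨?_, h6⟩) _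
        · push_cast; omega
        · push_cast; omega
        · push_cast at h5; omega

variable {r : ℕ}

theorem monomial_mem_iff_of_perm (hperm : PermutationProperty {u} 1 {u} {(vacuum : V)})
    (hlow : lowerSpan u r 0 ≤ C) {l l' : List ℤ} (h : l.Perm l') (hr : l.length = r) :
    monomial u l ∈ C ↔ monomial u l' ∈ C :=
  have hsub := hlow (monomial_sub_mem_lowerSpan hperm h hr.le)
  ⟨fun hl => (C.sub_mem_iff_right hl).1 hsub, fun hl => (C.sub_mem_iff_left hl).1 hsub⟩

/-- Monomials with modes below `u_{-2n}` reduce to monomials in `u_{-1}, …, u_{-2n}`; if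
`0 < |wt u| ≤ n`, the number of factors `u_{-1}` is preserved. -/
theorem monomial_mem_of_forall_small (hn : 1 ≤ n) (hu : u ∈ weightSpace (V := V) w)
    (hw : -(n : ℤ) ≤ w) (hO : zhuO V n ≤ C) (hstar : ∀ a ∈ C, ∀ b ∈ C, star n a b ∈ C)
    (huC : u ∈ C) (hperm : PermutationProperty {u} 1 {u} {(vacuum : V)})
    (hlow : lowerSpan u r 0 ≤ C) (Q : ℕ → Prop) (hQ : starCoeff n w = 0 ∨ ∀ p, Q p)
    (h : ∀ l : List ℤ, (∀ k ∈ l, -(2 * n : ℤ) ≤ k ∧ k ≤ -1) → l.length = r → Q (l.count (-1)) →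
      monomial u l ∈ C) :
    ∀ l : List ℤ, (∀ k ∈ l, k ≤ -1) → l.length = r → Q (l.count (-1)) → monomial u l ∈ C := by
  intro l
  induction hN : (l.map Int.natAbs).sum using Nat.strong_induction_on generalizing l with
  | _ N ih =>
    intro hl hr hq
    by_cases hall : ∀ k ∈ l, -(2 * n : ℤ) ≤ k
    · exact h l (fun k hk => ⟨hall k hk, hl k hk⟩) hr hq
    push Not at hall
    obtain ⟨k, hk, hk2⟩ := hall
    have hp := List.perm_cons_erase hk
    rw [monomial_mem_iff_of_perm hperm hlow hp hr]
    set l' := l.erase k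
    have hl' : ∀ a ∈ l', a ≤ -1 := fun a ha => hl a (List.mem_of_mem_erase ha)
    have hlen : l'.length + 1 = r := by rw [← hr, hp.length_eq, List.length_cons]
    have hy : monomial u l' ∈ lowerSpan u r 0 := monomial_mem_lowerSpan hl' (Or.inl (by omega))
    -- The induction is on the sum of the absolute values of the mode indices.
    have hsum : (l.map Int.natAbs).sum = k.natAbs + (l'.map Int.natAbs).sum := by
      rw [(hp.map _).sum_eq, List.map_cons, List.sum_cons]
    obtain ⟨K, rfl⟩ : ∃ K : ℕ, k = -(K : ℤ) := ⟨(-k).toNat, by omega⟩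
    refine mode_mem_of_forall_mode_mem hn hu hw hO (hstar u huC _ (hlow hy)) (by omega)
      (fun j hj => hlow (mode_mem_lowerSpan_of_nonneg hperm hj hy)) fun j hj hj1 hj2 => ?_
    refine ih _ ?_ (j :: l') rfl (by simpa [hj1] using hl') (by simpa using hlen) ?_
    · rw [List.map_cons, List.sum_cons]
      omega
    · rcases hQ with hQ | hQ
      · rw [hp.count_eq] at hq
        rw [List.count_cons_of_ne (by rintro rfl; exact hj2 rfl hQ)]
        rwa [List.count_cons_of_ne (by omega)] at hq
      · exact hQ _

theorem lowerSpan_le (hlow : lowerSpan u r 0 ≤ C) {p : ℕ}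
    (h : ∀ l : List ℤ, (∀ k ∈ l, k ≤ -1) → l.length = r → l.count (-1) < p → monomial u l ∈ C) :
    lowerSpan u r p ≤ C := by
  refine Submodule.span_le.2 ?_
  rintro _ ⟨l, hl, hr | ⟨hr, hp⟩, rfl⟩
  · exact hlow (monomial_mem_lowerSpan hl (Or.inl hr))
  · exact h l hl hr hp

/-- If `0 < |wt u| ≤ n`, the product with `u_{-1}^p 𝟏` removes factors `u_{-1}` from a monomial that
contains `p` of them, as long as `|p wt u| > n`. -/
theorem monomial_mem_of_small_weight (hn : 1 ≤ n) (hu : u ∈ weightSpace (V := V) w)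
    (hw : -(n : ℤ) ≤ w) (hw0 : starCoeff n w = 0) (hO : zhuO V n ≤ C)
    (hstar : ∀ a ∈ C, ∀ b ∈ C, star n a b ∈ C)
    (hpow : ∀ j : ℕ, (mode u (-1) ^ j) vacuum ∈ C)
    (hperm : PermutationProperty {u} 1 {u} {(vacuum : V)})
    (hlow : lowerSpan u r 0 ≤ C)
    (hbase : ∀ l : List ℤ, (∀ k ∈ l, -(2 * n : ℤ) ≤ k ∧ k ≤ -1) → l.length = r →
      -(n : ℤ) ≤ l.count (-1) * w → l.count (-1) * w ≤ n → monomial u l ∈ C) (p : ℕ) :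
    ∀ l : List ℤ, (∀ k ∈ l, k ≤ -1) → l.length = r → l.count (-1) = p → monomial u l ∈ C := by
  induction p using Nat.strong_induction_on with
  | _ p ih =>
    have huC : u ∈ C := by simpa [mode_neg_one_vacuum, mode] using hpow 1
    refine monomial_mem_of_forall_small hn hu hw hO hstar huC hperm hlow (· = p) (Or.inl hw0) ?_
    rintro l hl hr rfl
    by_cases hlw : -(n : ℤ) ≤ l.count (-1) * w ∧ l.count (-1) * w ≤ n
    · exact hbase l hl hr hlw.1 hlw.2
    set p := l.count (-1)
    have hp : p ≠ 0 := fun h => hlw (by rw [h]; simp)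
    set l' := l.filter (· ≠ -1) with hl'_def
    have hperm' : l.Perm (List.replicate p (-1) ++ l') := by
      rw [List.perm_iff_count]
      intro a
      rw [List.count_append, List.count_replicate]
      by_cases ha : a = -1
      · subst ha
        have : l'.count (-1) = 0 := List.count_eq_zero.2 (by simp [l'])
        simp [this, p]
      · rw [if_neg (by simpa using fun h => ha h.symm), List.count_filter (by simpa using ha)]
        simp
    have hlen : l'.length + p = r := by
      rw [← hr, hperm'.length_eq, List.length_append, List.length_replicate, add_comm]
    have hl' : ∀ k ∈ l', k ≤ -1 := fun k hk => (hl k (List.mem_of_mem_filter hk)).2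
    have hc : l'.count (-1) = 0 := List.count_eq_zero.2 (by simp [l'])
    obtain ⟨h₀, h₁, h₂⟩ := mode_pow_monomial hperm hl' p
    rw [hlen] at h₀ h₁ h₂
    rw [hc, zero_add] at h₂
    have hle : lowerSpan u r p ≤ C := lowerSpan_le hlow fun m hm hmr hmp => ih _ hmp m hm hmr rfl
    have hs := hstar _ (hpow p) (monomial u l')
      (hlow (monomial_mem_lowerSpan hl' (Or.inl (by omega))))
    rw [star_of_mem (mode_neg_one_pow_vacuum_mem_weightSpace hu p)] at hs
    have hall : ∀ k : ℤ, k ≠ -1 → mode ((mode u (-1) ^ p) vacuum) k (monomial u l') ∈ C := by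
      intro k hk
      rcases le_or_gt 0 k with h0 | h0
      · exact hlow (h₀ k h0)
      · exact hle (h₂ k (by omega))
    have h3 := (C.sub_mem_iff_right hs).1
      (starHom_sub_mem C n hn (p * w) _ (monomial u l') fun k _ hk => hall k hk)
    have h4 := (C.add_mem_iff_left (C.toAddSubgroup.zsmul_mem (hall _ (by omega)) _)).1 h3
    rw [zsmul_mem_iff_of_ne_zero C (by rw [Ne, starCoeff_eq_zero_iff]; tauto)] at h4
    rw [monomial_mem_iff_of_perm hperm hlow hperm' hr, monomial_replicate_append]
    exact (C.sub_mem_iff_right h4).1 (hlow h₁)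

/-- If `|wt u| > n` or `wt u = 0`, applying `L(-1) + L(0)` to `u_{-2n} y` expresses `u_{-2n-1} y`,
and then the product `u *ₙ y` expresses `u_{-1} y`, by monomials in which `u_{-1}` occurs less
often. -/
theorem monomial_mem_of_large_weight (hn : 1 ≤ n) (hu : u ∈ weightSpace (V := V) w)
    (hw0 : starCoeff n w ≠ 0) (hO : zhuO V n ≤ C)
    (hstar : ∀ a ∈ C, ∀ b ∈ C, star n a b ∈ C) (huC : u ∈ C)
    (hperm : PermutationProperty {u} 1 {u} {(vacuum : V)})
    (hlow : lowerSpan u r 0 ≤ C)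
    (hbase : ∀ l : List ℤ, (∀ k ∈ l, -(2 * n : ℤ) ≤ k ∧ k ≤ -1) → l.length = r →
      l.count (-1) = 0 → monomial u l ∈ C) (p : ℕ) :
    ∀ l : List ℤ, (∀ k ∈ l, -(2 * n : ℤ) ≤ k ∧ k ≤ -1) → l.length = r → l.count (-1) ≤ p →
      monomial u l ∈ C := by
  induction p with
  | zero => exact fun l hl hr hp => hbase l hl hr (by omega)
  | succ p ih =>
    intro l hl hr hp
    rcases hp.lt_or_eq with hp | hp
    · exact ih l hl hr (by omega)
    have hp1 := List.perm_cons_erase (List.count_pos_iff.1 (show 0 < l.count (-1) by omega))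
    rw [monomial_mem_iff_of_perm hperm hlow hp1 hr]
    set l' := l.erase (-1)
    have hl' : ∀ k ∈ l', -(2 * n : ℤ) ≤ k ∧ k ≤ -1 := fun a ha => hl a (List.mem_of_mem_erase ha)
    have hlen : l'.length + 1 = r := by rw [← hr, hp1.length_eq, List.length_cons]
    have hcount : l'.count (-1) = p := by
      rw [hp1.count_eq, List.count_cons_self] at hp
      omega
    have hcons : ∀ k : ℤ, -(2 * n : ℤ) ≤ k → k ≤ -2 → monomial u (k :: l') ∈ C := by
      intro k hk hk2
      refine ih _ (by
        intro a ha
        rcases List.mem_cons.1 ha with rfl | ha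
        · omega
        · exact hl' a ha) (by simpa using hlen) ?_
      rw [List.count_cons_of_ne (by omega), hcount]
    set m := -(2 * n : ℤ) :: l' with hm
    have hmC : monomial u m ∈ C := hcons _ le_rfl (by omega)
    have hmr : m.length = r := by simpa [hm] using hlen
    have hmem : ∀ a ∈ m, -(2 * n : ℤ) ≤ a ∧ a ≤ -1 := by
      intro a ha
      rcases List.mem_cons.1 ha with rfl | ha
      · omega
      · exact hl' a ha
    have hmcount : m.count (-1) = p := by rw [hm, List.count_cons_of_ne (by omega), hcount]
    set Z := monomial u ((-(2 * n + 1 : ℤ)) :: l') with hZ_def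
    have hL : virasoroL (-1) (monomial u m) ∈ C := by
      obtain ⟨c, hc⟩ := exists_monomial_mem_weightSpace hu m
      have h0 : virasoroL 0 (monomial u m) ∈ C := by
        have h1 : virasoroL 0 (monomial u m) = (c : ℂ) • monomial u m := weightSpace_eigen c _ hc
        rw [h1]
        exact C.smul_mem _ hmC
      exact (C.add_mem_iff_left h0).1 (hO (Submodule.subset_span (Or.inr ⟨_, rfl⟩)))
    -- Up to `C`, the `i`-th term of `L(-1)` applied to `m` is `2n Z` if the `i`-th factor is `u_{-2n}`,
    -- and `0` otherwise.
    have hterm : ∀ i : Fin m.length, (-(m[i] : ℂ)) • monomial u (m.set i (m[i] - 1)) -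
        ((if m[i] = -(2 * n : ℤ) then 2 * n else 0 : ℕ) : ℂ) • Z ∈ C := by
      intro i
      have hset := List.set_perm_cons_eraseIdx i.2 (m[i] - 1)
      have hget := List.getElem_cons_eraseIdx_perm i.2
      have hi := hmem m[i] (List.getElem_mem i.2)
      have hsetr : (m.set i (m[i] - 1)).length = r := by rw [List.length_set, hmr]
      split_ifs with h
      · have h1 : (m.eraseIdx i).Perm l' := by
          have h2 : (m[i] :: m.eraseIdx i).Perm m := hget
          rw [h] at h2
          exact h2.cons_inv
        have h3 : (m.set i (m[i] - 1)).Perm ((-(2 * n + 1 : ℤ)) :: l') := by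
          refine hset.trans ?_
          rw [h, show -(2 * n : ℤ) - 1 = -(2 * n + 1 : ℤ) by ring]
          exact h1.cons _
        have h4 := hlow (monomial_sub_mem_lowerSpan hperm h3 hsetr.le)
        convert C.smul_mem (2 * n : ℂ) h4 using 1
        rw [smul_sub, h]
        push_cast
        rw [neg_neg]
      · rw [Nat.cast_zero, zero_smul, sub_zero]
        refine C.smul_mem _ ((monomial_mem_iff_of_perm hperm hlow hset hsetr).2 (ih _ ?_ ?_ ?_))
        · intro a ha
          rcases List.mem_cons.1 ha with rfl | ha
          · omega
          · exact hmem a (List.mem_of_mem_eraseIdx ha)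
        · rw [← hset.length_eq, hsetr]
        · rw [List.count_cons_of_ne (by omega), ← hmcount]
          exact (List.eraseIdx_sublist _ _).count_le _
    -- At least the first factor of `m` is `u_{-2n}`, so a positive multiple of `Z` lies in `C`.
    have hZ : Z ∈ C := by
      rw [virasoroL_neg_one_monomial] at hL
      have h1 := C.sum_mem fun i (_ : i ∈ Finset.univ) => hterm i
      rw [Finset.sum_sub_distrib, C.sub_mem_iff_right hL] at h1
      rw [← Finset.sum_smul, ← Nat.cast_sum] at h1
      refine (Submodule.smul_mem_iff _ ?_).1 h1
      rw [Nat.cast_ne_zero, ← Nat.pos_iff_ne_zero]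
      refine Finset.sum_pos' (fun _ _ => Nat.zero_le _)
        ⟨⟨0, by simp [hm]⟩, Finset.mem_univ _, ?_⟩
      simp [hm]
      omega
    have hy : monomial u l' ∈ lowerSpan u r 0 :=
      monomial_mem_lowerSpan (fun k hk => (hl' k hk).2) (Or.inl (by omega))
    have hs := hstar u huC _ (hlow hy)
    rw [star_of_mem hu] at hs
    have h3 := (C.sub_mem_iff_right hs).1
      (starHom_sub_mem C n hn w u (monomial u l') fun k hk hk1 => by
        rcases le_or_gt 0 k with h0 | h0
        · exact hlow (mode_mem_lowerSpan_of_nonneg hperm h0 hy)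
        · exact hcons k (by omega) (by omega))
    exact (zsmul_mem_iff_of_ne_zero C hw0).1
      ((C.add_mem_iff_left (C.toAddSubgroup.zsmul_mem hZ _)).1 h3)

end Reduction

/-! ### Ordered monomials and the generators -/

/-- The list `[-N, …, -N, …, -1, …, -1]` in which `-k` is repeated `i k` times. -/
def orderedList (i : ℕ → ℕ) : ℕ → List ℤ
  | 0 => []
  | N + 1 => List.replicate (i (N + 1)) (-((N : ℤ) + 1)) ++ orderedList i N

theorem orderedMonomial_eq_monomial (u : V) (i : ℕ → ℕ) (N : ℕ) :
    orderedMonomial u i N = monomial u (orderedList i N) := by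
  induction N with
  | zero => rfl
  | succ N ih => rw [orderedMonomial, orderedList, monomial_replicate_append, ih]

theorem le_neg_one_of_mem_orderedList {i : ℕ → ℕ} {N : ℕ} {k : ℤ} (hk : k ∈ orderedList i N) :
    k ≤ -1 := by
  induction N with
  | zero => simp [orderedList] at hk
  | succ N ih =>
    rcases List.mem_append.1 hk with hk | hk
    · have := List.eq_of_mem_replicate hk
      omega
    · exact ih hk

theorem count_orderedList (i : ℕ → ℕ) (N : ℕ) (a : ℤ) :
    (orderedList i N).count a = if -(N : ℤ) ≤ a ∧ a ≤ -1 then i a.natAbs else 0 := by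
  induction N with
  | zero =>
    rw [if_neg (by omega)]
    rfl
  | succ N ih =>
    rw [orderedList, List.count_append, ih, List.count_replicate]
    simp only [beq_iff_eq]
    by_cases h : -((N : ℤ) + 1) = a
    · rw [if_pos h, if_neg (by omega), if_pos (by push_cast; omega), add_zero]
      congr 1
      omega
    · rw [if_neg h, zero_add]
      congr 1
      push_cast
      exact propext (by omega)

theorem perm_orderedList {l : List ℤ} {N : ℕ} (hl : ∀ k ∈ l, -(N : ℤ) ≤ k ∧ k ≤ -1) :
    l.Perm (orderedList (fun k => l.count (-(k : ℤ))) N) := by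
  rw [List.perm_iff_count]
  intro a
  rw [count_orderedList]
  split_ifs with h
  · congr 1
    omega
  · exact List.count_eq_zero.2 fun ha => h (hl a ha)

/-- A subspace that contains `Oₙ(V)` and the generators and is closed under `*ₙ` contains `⟨u⟩¹`. -/
theorem positivelyGenerated_le {n : ℕ} {u : V} {w : ℤ} {C : Submodule ℂ V} (hn : 1 ≤ n)
    (hu : u ∈ weightSpace (V := V) w) (hw : -(n : ℤ) ≤ w)
    (hperm : PermutationProperty {u} 1 {u} {(vacuum : V)}) (hO : zhuO V n ≤ C)
    (hstar : ∀ a ∈ C, ∀ b ∈ C, star n a b ∈ C)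
    (hpow : ∀ j : ℕ, (mode u (-1) ^ j) vacuum ∈ C)
    (hord : ∀ i : ℕ → ℕ, -(n : ℤ) ≤ i 1 * w → i 1 * w ≤ n → orderedMonomial u i (2 * n) ∈ C) :
    positivelyGenerated {u} 1 ≤ C := by
  have huC : u ∈ C := by simpa [mode_neg_one_vacuum, mode] using hpow 1
  have hlow : ∀ r : ℕ, lowerSpan u r 0 ≤ C := by
    intro r
    induction r with
    | zero =>
      refine Submodule.span_le.2 ?_
      rintro _ ⟨l, _, hr, _⟩
      omega
    | succ r hlow =>
      have hbase : ∀ l : List ℤ, (∀ k ∈ l, -(2 * n : ℤ) ≤ k ∧ k ≤ -1) → l.length = r →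
          -(n : ℤ) ≤ l.count (-1) * w → l.count (-1) * w ≤ n → monomial u l ∈ C := by
        intro l hl hr h1 h2
        rw [monomial_mem_iff_of_perm hperm hlow
          (perm_orderedList (N := 2 * n) (by exact_mod_cast hl)) hr,
          ← orderedMonomial_eq_monomial]
        exact hord _ (by simpa using h1) (by simpa using h2)
      have hmon : ∀ l : List ℤ, (∀ k ∈ l, k ≤ -1) → l.length = r → monomial u l ∈ C := by
        intro l hl hr
        by_cases hw0 : starCoeff n w = 0
        · exact monomial_mem_of_small_weight hn hu hw hw0 hO hstar hpow hperm hlow hbase _ l hl hr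
            rfl
        · refine monomial_mem_of_forall_small hn hu hw hO hstar huC hperm hlow (fun _ => True)
            (Or.inr fun _ => trivial) (fun m hm hmr _ => ?_) l hl hr trivial
          exact monomial_mem_of_large_weight hn hu hw0 hO hstar huC hperm hlow
            (fun m' h1 h2 h3 => hbase m' h1 h2 (by simp [h3]) (by simp [h3])) _ m hm hmr le_rfl
      refine Submodule.span_le.2 ?_
      rintro _ ⟨l, hl, hr, rfl⟩
      rcases Nat.lt_or_ge l.length r with h | h
      · exact hlow (monomial_mem_lowerSpan hl (Or.inl h))
      · exact hmon l hl (by omega)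
  rw [positivelyGenerated_singleton]
  refine Submodule.span_le.2 ?_
  rintro _ ⟨l, hl, rfl⟩
  exact hlow _ (monomial_mem_lowerSpan hl (Or.inl (Nat.lt_succ_self _)))

end VertexOperatorAlgebra

theorem mainTheorem3 {V : Type*} [AddCommGroup V] [Module ℂ V] [VertexOperatorAlgebra V]
    (n : ℕ) (hn : 1 ≤ n) (u : V) (w : ℤ)
    (hu : u ∈ VertexOperatorAlgebra.weightSpace (V := V) w) (hw : -(n : ℤ) ≤ w)
    (hgen : VertexAlgebra.generated {u} = VertexAlgebra.positivelyGenerated {u} 1)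
    (hperm : VertexAlgebra.PermutationProperty {u} 1 {u} {(VertexAlgebra.vacuum : V)}) :
    VertexOperatorAlgebra.zhuAdjoin n
        (VertexOperatorAlgebra.toZhu n ''
          (VertexAlgebra.positivelyGenerated {u} 1 : Set V)) =
      VertexOperatorAlgebra.zhuAdjoin n
        ({x | ∃ i : ℕ → ℕ, -(n : ℤ) ≤ (i 1 : ℤ) * w ∧ (i 1 : ℤ) * w ≤ n ∧
            x = VertexOperatorAlgebra.toZhu n (VertexAlgebra.orderedMonomial u i (2 * n))} ∪
          {x | ∃ j : ℕ, 1 ≤ j ∧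
            x = VertexOperatorAlgebra.toZhu n
              (((VertexAlgebra.mode u (-1)) ^ j) VertexAlgebra.vacuum)}) := by
  open VertexAlgebra VertexOperatorAlgebra in
  have hmon : ∀ l : List ℤ, (∀ k ∈ l, k ≤ -1) → monomial u l ∈ positivelyGenerated {u} 1 :=
    fun l hl => by
      rw [positivelyGenerated_singleton]
      exact Submodule.subset_span ⟨l, hl, rfl⟩
  refine le_antisymm (sInf_le_sInf ?_) (sInf_le_sInf ?_)
  · rintro B ⟨hS, h1, hmul⟩
    refine ⟨?_, h1, hmul⟩
    rintro _ ⟨v, hv, rfl⟩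
    refine VertexOperatorAlgebra.positivelyGenerated_le
      (C := B.comap (VertexOperatorAlgebra.zhuO V n).mkQ) hn hu hw hperm ?_
      (fun a ha b hb => hmul a b ha hb) ?_ ?_ hv
    · exact (VertexOperatorAlgebra.zhuO V n).le_comap_mkQ B
    · intro j
      rcases Nat.eq_zero_or_pos j with rfl | hj
      · exact h1
      · exact hS (Or.inr ⟨j, hj, rfl⟩)
    · exact fun i hi hi' => hS (Or.inl ⟨i, hi, hi', rfl⟩)
  · rintro B ⟨hS, h1, hmul⟩
    refine ⟨?_, h1, hmul⟩
    rintro _ (⟨i, _, _, rfl⟩ | ⟨j, _, rfl⟩)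
    · rw [VertexOperatorAlgebra.orderedMonomial_eq_monomial]
      exact hS ⟨_, hmon _ fun k hk => VertexOperatorAlgebra.le_neg_one_of_mem_orderedList hk, rfl⟩
    · rw [← VertexAlgebra.monomial_replicate]
      exact hS ⟨_, hmon _ fun k hk => (List.eq_of_mem_replicate hk).le, rfl⟩
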